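/- For a nonzero algebraic number $\alpha\in\overline{\mathbb Q}^\times$ let $M(\alpha)=\log|a|+\sum_{n=1}^N\log^+|\alpha_n|$ be its logarithmic Mahler measure, where $a\prod_{n=1}^N(z-\alpha_n)$ is the minimal polynomial of $\alpha$ over $\mathbb Z$. For $t\in(0,\infty]$ define the $t$-metric Mahler measure by $$M_t(\alpha)=\inf\bigl\{\|(M(\alpha_1),M(\alpha_2),\ldots)\|_t\bigr\},$$ where the infimum is over all sequences $(\alpha_1,\alpha_2,\ldots)$ in $\overline{\mathbb Q}^\times$ with $\alpha_n=1$ for all but finitely many $n$ and $\prod_n\alpha_n=\alpha$, and where $\|x\|_t=(\sum_n|x_n|^t)^{1/t}$ for $t<\infty$ and $\|x\|_\infty=\max_n|x_n|$. Let $V=\overline{\mathbb Q}^\times/\mathrm{Tor}(\overline{\mathbb Q}^\times)$ be the quotient by the group of roots of unity. The function $M_t$ is well defined on $V$, and for $t\ge 1$ it induces on $V$ the topology of the distance $(\alpha,\beta)\mapsto M_t(\alpha\beta^{-1})$. Lehmer's conjecture is the assertion that there is a real number $c>0$ such that $M(\alpha)\ge c$ for every $\alpha\in\overline{\mathbb Q}^\times$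 which is not a root of unity. **Theorem.** Lehmer's conjecture is true if and only if there exists $t\in[1,\infty)$ such that $M_t$ and $M_\infty$ induce the same topology on $V$. Moreover, for every $t\in[1,\infty)$ and every $\alpha\in\overline{\mathbb Q}^\times$ that is not a root of unity, $M_t(\alpha^s)\to\infty$ as $s\to\infty$ through the positive integers. -/

import Mathlib

open scoped ENNReal

/-- The norm `‖x‖_t`, for `t ∈ (0, ∞]`, of a finitely supported sequence of real numbers. -/
noncomputable def tNorm (t : ℝ≥0∞) (x : ℕ → ℝ) : ℝ :=
  if t = ∞ then ⨆ n, |x n| else (∑ᶠ n, |x n| ^ t.toReal) ^ (1 / t.toReal)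

/-- The factorizations of `α`: the sequences in `G`, trivial at all but finitely many places,
whose product is `α`. -/
def factorizations {G : Type*} [CommGroup G] (α : G) : Set (ℕ → G) :=
  {a | (Function.mulSupport a).Finite ∧ ∏ᶠ n, a n = α}

/-- The `t`-metric version `φ_t` of a height `φ` on an abelian group: the infimum of
`‖(φ(α₁), φ(α₂), …)‖_t` over all factorizations of `α`. -/
noncomputable def metricVersion {G : Type*} [CommGroup G] (φ : G → ℝ) (t : ℝ≥0∞) (α : G) : ℝ :=
  sInf ((fun a : ℕ → G => tNorm t (fun n => φ (a n))) '' factorizations α)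

/-- The field of algebraic numbers. -/
abbrev AlgNum : Type := AlgebraicClosure ℚ

/-- The minimal polynomial of an algebraic number over `ℤ` (primitive, irreducible, determined up
to sign): the primitive part of the minimal polynomial over `ℚ` after clearing denominators. -/
noncomputable def intMinpoly (α : AlgNum) : Polynomial ℤ :=
  (IsLocalization.integerNormalization (nonZeroDivisors ℤ) (minpoly ℚ α)).primPart

/-- The logarithmic Mahler measure of a nonzero algebraic number. -/
noncomputable def mahlerMeas (α : AlgNumˣ) : ℝ :=
  ((intMinpoly (α : AlgNum)).map (Int.castRingHom ℂ)).logMahlerMeasure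

/-- `M(α) = log |a| + ∑ log⁺ |αₙ|`, where `a` is the leading coefficient of the minimal polynomial
of `α` over `ℤ` and the `αₙ` are its complex roots. -/
theorem mahlerMeas_eq (α : AlgNumˣ) :
    mahlerMeas α = Real.log |((intMinpoly (α : AlgNum)).leadingCoeff : ℝ)| +
      (((intMinpoly (α : AlgNum)).map (Int.castRingHom ℂ)).roots.map
        (fun z => Real.posLog ‖z‖)).sum := by
  rw [mahlerMeas, Polynomial.logMahlerMeasure_eq_log_leadingCoeff_add_sum_log_roots,
    Polynomial.leadingCoeff_map_of_injective (RingHom.injective_int _)]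
  simp

theorem intMinpoly_isPrimitive (α : AlgNum) : (intMinpoly α).IsPrimitive :=
  Polynomial.isPrimitive_primPart _

/-- Over `ℚ`, the polynomial `intMinpoly α` is a nonzero constant multiple of `minpoly ℚ α`. -/
theorem intMinpoly_map (α : AlgNum) : ∃ q : ℚ, q ≠ 0 ∧
    (intMinpoly α).map (Int.castRingHom ℚ) = Polynomial.C q * minpoly ℚ α := by
  obtain ⟨b, hbM, hb⟩ := IsLocalization.integerNormalization_spec (nonZeroDivisors ℤ)
    (minpoly ℚ α)
  set P := IsLocalization.integerNormalization (nonZeroDivisors ℤ) (minpoly ℚ α) with hP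
  have hbz : b ≠ 0 := nonZeroDivisors.ne_zero hbM
  have hb0 : (b : ℚ) ≠ 0 := by exact_mod_cast hbz
  have hP0 : P ≠ 0 := by
    intro h
    rw [h, Polynomial.map_zero] at hb
    have h1 : minpoly ℚ α ≠ 0 := minpoly.ne_zero 
      ((AlgebraicClosure.isAlgebraic ℚ).isAlgebraic α).isIntegral
    have h2 : b • minpoly ℚ α ≠ 0 := smul_ne_zero hbz h1
    exact h2 hb.symm
  have hc0 : ((P.content : ℤ) : ℚ) ≠ 0 := by
    exact_mod_cast fun h => hP0 (Polynomial.content_eq_zero_iff.mp h)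
  refine ⟨((P.content : ℤ) : ℚ)⁻¹ * b, mul_ne_zero (inv_ne_zero hc0) hb0, ?_⟩
  have h1 : P.map (Int.castRingHom ℚ) =
      Polynomial.C ((P.content : ℤ) : ℚ) * (intMinpoly α).map (Int.castRingHom ℚ) := by
    conv_lhs => rw [P.eq_C_content_mul_primPart]
    rw [Polynomial.map_mul, Polynomial.map_C]
    rfl
  have h2 : P.map (Int.castRingHom ℚ) = Polynomial.C (b : ℚ) * minpoly ℚ α := by
    have : P.map (Int.castRingHom ℚ) = b • minpoly ℚ α := hb
    rw [this, zsmul_eq_mul]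
    simp
  rw [Polynomial.C_mul, mul_assoc, ← h2, h1, ← mul_assoc, ← Polynomial.C_mul,
    inv_mul_cancel₀ hc0, Polynomial.C_1, one_mul]

/-- Roots of unity have Mahler measure zero. -/
theorem mahlerMeas_eq_zero_of_isOfFinOrder {ζ : AlgNumˣ} (hζ : IsOfFinOrder ζ) : mahlerMeas ζ = 0 := by
  have hn : 0 < orderOf ζ := hζ.orderOf_pos
  have hprim : IsPrimitiveRoot (ζ : AlgNum) (orderOf ζ) := by
    rw [IsPrimitiveRoot.coe_units_iff]
    exact IsPrimitiveRoot.orderOf ζ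
  obtain ⟨q, hq, hmap⟩ := intMinpoly_map (ζ : AlgNum)
  rw [← Polynomial.cyclotomic_eq_minpoly_rat hprim hn, ← Polynomial.map_cyclotomic_int] at hmap
  have hcyc := Polynomial.cyclotomic.isPrimitive (orderOf ζ) ℤ
  have hass : Associated (intMinpoly (ζ : AlgNum)) (Polynomial.cyclotomic (orderOf ζ) ℤ) := by
    apply associated_of_dvd_dvd
    · rw [Polynomial.IsPrimitive.Int.dvd_iff_map_cast_dvd_map_cast _ _
        (intMinpoly_isPrimitive _), hmap]
      exact ((Polynomial.isUnit_C.mpr hq.isUnit).mul_left_dvd).mpr dvd_rfl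
    · rw [Polynomial.IsPrimitive.Int.dvd_iff_map_cast_dvd_map_cast _ _ hcyc, hmap]
      exact dvd_mul_left _ _
  obtain ⟨u, hu⟩ := hass.symm
  obtain ⟨r, hr, hru⟩ := Polynomial.isUnit_iff.mp u.isUnit
  have hr1 : ‖(Int.castRingHom ℂ r)‖ = 1 := by
    rcases Int.isUnit_iff.mp hr with h | h <;> simp [h]
  have hm := Polynomial.cyclotomic_mahlerMeasure_eq_one (R := ℤ) (orderOf ζ)
  rw [mahlerMeas, Polynomial.logMahlerMeasure_eq_log_MahlerMeasure, ← hu, ← hru, Polynomial.map_mul,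
    Polynomial.mahlerMeasure_mul, Polynomial.map_C, Polynomial.mahlerMeasure_const, hr1, mul_one]
  have : ((Polynomial.cyclotomic (orderOf ζ) ℤ).map (Int.castRingHom ℂ)).mahlerMeasure = 1 := hm
  rw [this, Real.log_one]

/-- The `t`-metric Mahler measure `M_t`, `t ∈ (0, ∞]`; the ultrametric one is `M_∞`. -/
noncomputable def metricMahler (t : ℝ≥0∞) (α : AlgNumˣ) : ℝ := metricVersion mahlerMeas t α

/-- Lehmer's conjecture: a uniform positive lower bound for the Mahler measure away from the
roots of unity. -/
def LehmerConjecture : Prop :=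
  ∃ c : ℝ, 0 < c ∧ ∀ α : AlgNumˣ, ¬ IsOfFinOrder α → c ≤ mahlerMeas α

/-- The group of nonzero algebraic numbers modulo roots of unity. -/
abbrev AlgModTors : Type := AlgNumˣ ⧸ CommGroup.torsion AlgNumˣ

theorem metricMahler_mul_le_aux (t : ℝ≥0∞) (α ζ : AlgNumˣ) (hζ : IsOfFinOrder ζ) :
    (fun a : ℕ → AlgNumˣ => tNorm t (fun n => mahlerMeas (a n))) '' factorizations α ⊆
      (fun a : ℕ → AlgNumˣ => tNorm t (fun n => mahlerMeas (a n))) '' factorizations (α * ζ) := by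
  rintro _ ⟨a, ⟨hfin, hprod⟩, rfl⟩
  obtain ⟨m, hm⟩ := hfin.exists_notMem
  have hm1 : a m = 1 := by simpa using hm
  have hsub : Function.mulSupport (Pi.mulSingle m ζ : ℕ → AlgNumˣ) ⊆ {m} :=
    Pi.mulSupport_mulSingle_subset
  have hsfin := (Set.finite_singleton m).subset hsub
  refine ⟨fun n => a n * (Pi.mulSingle m ζ : ℕ → AlgNumˣ) n, ⟨?_, ?_⟩, ?_⟩
  · exact (hfin.union hsfin).subset (Function.mulSupport_mul _ _)
  · rw [finprod_mul_distrib hfin hsfin, hprod, finprod_eq_single _ m]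
    · simp
    · intro n hn
      simp [Pi.mulSingle_eq_of_ne hn]
  · dsimp only
    congr 1
    funext n
    by_cases hn : n = m
    · subst hn
      rw [hm1, one_mul, Pi.mulSingle_eq_same, mahlerMeas_eq_zero_of_isOfFinOrder hζ,
        mahlerMeas_eq_zero_of_isOfFinOrder IsOfFinOrder.one]
    · rw [Pi.mulSingle_eq_of_ne hn, mul_one]

/-- `M_t` is invariant under multiplication by roots of unity. -/
theorem metricMahler_mul (t : ℝ≥0∞) (α ζ : AlgNumˣ) (hζ : IsOfFinOrder ζ) :
    metricMahler t (α * ζ) = metricMahler t α := by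
  unfold metricMahler metricVersion
  congr 1
  apply Set.Subset.antisymm
  · have h := metricMahler_mul_le_aux t (α * ζ) ζ⁻¹ hζ.inv
    rwa [mul_inv_cancel_right] at h
  · exact metricMahler_mul_le_aux t α ζ hζ

/-- The function on the quotient by the roots of unity which `M_t` induces. -/
noncomputable def metricMahlerQuot (t : ℝ≥0∞) : AlgModTors → ℝ :=
  Quotient.lift (metricMahler t) (by
    intro α β h
    have h' : α⁻¹ * β ∈ CommGroup.torsion AlgNumˣ := QuotientGroup.leftRel_apply.mp h
    have := metricMahler_mul t α (α⁻¹ * β) h'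
    rw [mul_inv_cancel_left] at this
    exact this.symm)

/-- The topology which a real function `ψ` on a group `V` induces through the distance function
`(v, w) ↦ ψ(v w⁻¹)`: a set is open if it contains a ball of positive radius around each of its
points. -/
@[reducible] def heightTopology {V : Type*} [Group V] (ψ : V → ℝ) : TopologicalSpace V where
  IsOpen U := ∀ v ∈ U, ∃ r : ℝ, 0 < r ∧ {w | ψ (v * w⁻¹) < r} ⊆ U
  isOpen_univ := fun _ _ => ⟨1, one_pos, Set.subset_univ _⟩
  isOpen_inter := by
    rintro U W hU hW v ⟨hvU, hvW⟩
    obtain ⟨r, hr, hrU⟩ := hU v hvU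
    obtain ⟨s, hs, hsW⟩ := hW v hvW
    exact ⟨min r s, lt_min hr hs, fun w (hw : ψ (v * w⁻¹) < min r s) =>
      ⟨hrU (show ψ (v * w⁻¹) < r from lt_of_lt_of_le hw (min_le_left _ _)),
        hsW (show ψ (v * w⁻¹) < s from lt_of_lt_of_le hw (min_le_right _ _))⟩⟩
  isOpen_sUnion := by
    rintro S hS v ⟨U, hUS, hvU⟩
    obtain ⟨r, hr, hrU⟩ := hS U hUS v hvU
    exact ⟨r, hr, hrU.trans (Set.subset_sUnion_of_mem hUS)⟩

/-- The topology which `M_t` induces on the group of nonzero algebraic numbers modulo roots of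
unity. -/
@[reducible] noncomputable def mahlerTopology (t : ℝ≥0∞) : TopologicalSpace AlgModTors :=
  heightTopology (metricMahlerQuot t)

/-! ### Metric versions of a height on an abelian group. -/

section MetricVersion

/-! If Lehmer's conjecture holds with constant `c`, every factorization of a non-torsion element has
a non-torsion factor, so each `M_t` is at least `c` off the identity of `V` and all the topologies
are discrete (`mahlerTopology_eq_bot`).

The converse plays two behaviours of powers against each other. `M_∞(α ^ s) ≤ M(α)` for all `s`,
while for finite `t ≥ 1` and non-torsion `α`, `M_t(α ^ s) → ∞`. If the topologies agree, some
`M_∞`-ball about 1 lies in the unit `M_t`-ball; an `α` with `M(α)` below its radius would keep all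
its powers there, so that radius is a Lehmer constant.

For the growth, put `K = ℚ(α)` and choose a place `v` of `K` with `v(α) > 1` (Kronecker,
`exists_mahlerDominates`). Given a factorization of `α ^ s`, take norms to `K` from a field `E`
containing all the factors. A factor `x` contributes at most `[E : K] * C * M(x)` to `[E : K] * s *
log v(α)`, and contributes positively only if `M(x) ≥ c`, with `C` and `c` depending only on `K` and
`v`. Hence `M(x)` may be replaced by `M(x) ^ p / c ^ (p - 1)`, and `∑ M(x) ^ p` grows at least
linearly in `s`. -/

@[to_additive]
theorem finprod_sumElim {ι κ M : Type*} [CommMonoid M] {f : ι → M} {g : κ → M}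
    (hf : (Function.mulSupport f).Finite) (hg : (Function.mulSupport g).Finite) :
    ∏ᶠ i, Sum.elim f g i = (∏ᶠ i, f i) * ∏ᶠ i, g i := by
  rw [finprod_eq_prod_of_mulSupport_subset (s := hf.toFinset.disjSum hg.toFinset),
    Finset.prod_disjSum, finprod_eq_prod _ hf, finprod_eq_prod _ hg]
  · rfl
  · rintro (i | i) hi <;> simpa using hi

theorem tNorm_nonneg (t : ℝ≥0∞) (x : ℕ → ℝ) : 0 ≤ tNorm t x := by
  unfold tNorm
  split_ifs
  · exact Real.iSup_nonneg fun n => abs_nonneg _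
  · exact Real.rpow_nonneg (finsum_nonneg fun n => Real.rpow_nonneg (abs_nonneg _) _) _

theorem abs_le_tNorm {t : ℝ≥0∞} (ht : t ≠ 0) {x : ℕ → ℝ} (hx : (Function.support x).Finite)
    (n : ℕ) : |x n| ≤ tNorm t x := by
  unfold tNorm
  split_ifs with h
  · refine le_ciSup (f := fun n => |x n|) (Set.Finite.bddAbove ?_) n
    refine ((hx.image fun n => |x n|).union (Set.finite_singleton 0)).subset ?_
    rintro _ ⟨m, rfl⟩
    by_cases hm : x m = 0
    · right; simp [hm]
    · left; exact ⟨m, hm, rfl⟩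
  · have hp := ENNReal.toReal_pos ht h
    rw [one_div, Real.le_rpow_inv_iff_of_pos (abs_nonneg _) _ hp]
    · refine single_le_finsum n (hx.subset ?_) (fun m => Real.rpow_nonneg (abs_nonneg _) _)
      intro m hm h0
      exact hm (by simp [h0, Real.zero_rpow hp.ne'])
    · exact finsum_nonneg fun n => Real.rpow_nonneg (abs_nonneg _) _

variable {G : Type*} [CommGroup G] {φ : G → ℝ}

theorem support_comp_finite (h1 : φ 1 = 0) {α : G} {a : ℕ → G} (ha : a ∈ factorizations α) :
    (Function.support fun n => φ (a n)).Finite :=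
  ha.1.subset fun n hn h => hn (by simp [h, h1])

theorem factorizations_nonempty (α : G) : (factorizations α).Nonempty :=
  ⟨Pi.mulSingle 0 α, (Set.finite_singleton 0).subset Pi.mulSupport_mulSingle_subset, by
    rw [finprod_eq_single _ 0 fun n hn => Pi.mulSingle_eq_of_ne hn _, Pi.mulSingle_eq_same]⟩

theorem metricVersion_le {t : ℝ≥0∞} {α : G} {a : ℕ → G} (ha : a ∈ factorizations α) :
    metricVersion φ t α ≤ tNorm t (fun n => φ (a n)) :=
  csInf_le ⟨0, by rintro _ ⟨b, -, rfl⟩; exact tNorm_nonneg _ _⟩ ⟨a, ha, rfl⟩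

theorem le_metricVersion {t : ℝ≥0∞} {α : G} {r : ℝ}
    (h : ∀ a ∈ factorizations α, r ≤ tNorm t (fun n => φ (a n))) : r ≤ metricVersion φ t α :=
  le_csInf ((factorizations_nonempty α).image _) (by rintro _ ⟨a, ha, rfl⟩; exact h a ha)

theorem metricVersion_one (h1 : φ 1 = 0) {t : ℝ≥0∞} (ht : t ≠ 0) : metricVersion φ t 1 = 0 := by
  refine le_antisymm ((metricVersion_le (a := 1) ⟨by simp, by simp⟩).trans_eq ?_)
    (le_metricVersion fun a _ => tNorm_nonneg _ _)
  unfold tNorm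
  split_ifs with h
  · simp [h1]
  · have := ENNReal.toReal_pos ht h
    simp [h1, Real.zero_rpow this.ne', this.ne']

/-- The maximum norm does not see repetition: use `s` copies of `α`. -/
theorem metricVersion_top_pow_le (h0 : ∀ x, 0 ≤ φ x) (h1 : φ 1 = 0) (α : G) (s : ℕ) :
    metricVersion φ ∞ (α ^ s) ≤ φ α := by
  refine (metricVersion_le (a := fun n => if n ∈ Finset.range s then α else 1) ?_).trans ?_
  · have hsub : (Function.mulSupport fun n => if n ∈ Finset.range s then α else 1) ⊆
        (Finset.range s : Set ℕ) := by
      intro n hn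
      by_contra h
      exact hn (if_neg h)
    refine ⟨(Finset.finite_toSet _).subset hsub, ?_⟩
    rw [finprod_eq_prod_of_mulSupport_subset _ hsub, Finset.prod_ite_mem]
    simp
  · rw [tNorm, if_pos rfl]
    refine ciSup_le fun n => ?_
    split_ifs
    · exact (abs_of_nonneg (h0 α)).le
    · simp [h1, h0 α]

/-- Merging two factorizations adds the sums of `p`-th powers, and `u ↦ u ^ (1 / p)` is subadditive
for `p ≥ 1`. -/
theorem metricVersion_mul_le (h1 : φ 1 = 0) {t : ℝ≥0∞} (ht : 1 ≤ t) (ht' : t ≠ ∞) (α β : G) :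
    metricVersion φ t (α * β) ≤ metricVersion φ t α + metricVersion φ t β := by
  rw [← sub_le_iff_le_add]
  refine le_metricVersion fun a ha => ?_
  rw [sub_le_iff_le_add, ← sub_le_iff_le_add']
  refine le_metricVersion fun b hb => ?_
  rw [sub_le_iff_le_add']
  set e := Equiv.natSumNatEquivNat
  have hc : (fun n => Sum.elim a b (e.symm n)) ∈ factorizations (α * β) := by
    constructor
    · refine (((ha.1.image Sum.inl).union (hb.1.image Sum.inr)).image e).subset ?_
      intro n hn
      obtain ⟨i, rfl⟩ := e.surjective n
      refine ⟨i, ?_, rfl⟩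
      rcases i with i | i <;> simpa using hn
    · rw [finprod_comp_equiv (f := Sum.elim a b) e.symm, finprod_sumElim ha.1 hb.1, ha.2, hb.2]
  refine (metricVersion_le hc).trans ?_
  have hp : 0 < t.toReal := ENNReal.toReal_pos (one_pos.trans_le ht).ne' ht'
  have hp1 : 1 ≤ t.toReal := by simpa using (ENNReal.toReal_le_toReal ENNReal.one_ne_top ht').mpr ht
  have hfin : ∀ {γ : G} {d : ℕ → G}, d ∈ factorizations γ →
      (Function.support fun n => |φ (d n)| ^ t.toReal).Finite := fun hd =>
    (support_comp_finite h1 hd).subset fun n hn h => hn (by simp [h, Real.zero_rpow hp.ne'])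
  have hnn : ∀ d : ℕ → G, 0 ≤ ∑ᶠ n, |φ (d n)| ^ t.toReal := fun d =>
    finsum_nonneg fun n => Real.rpow_nonneg (abs_nonneg _) _
  have hsum : ∑ᶠ n, |φ (Sum.elim a b (e.symm n))| ^ t.toReal =
      (∑ᶠ n, |φ (a n)| ^ t.toReal) + ∑ᶠ n, |φ (b n)| ^ t.toReal := by
    rw [finsum_comp_equiv (f := fun i => |φ (Sum.elim a b i)| ^ t.toReal) e.symm,
      ← finsum_sumElim (hfin ha) (hfin hb)]
    refine finsum_congr ?_
    rintro (i | i) <;> rfl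
  simp only [tNorm, if_neg ht', hsum]
  exact Real.rpow_add_le_add_rpow (hnn a) (hnn b) (by positivity) (by
    rw [div_le_one hp]; exact hp1)

end MetricVersion

/-! ### Mahler measure and integrality. -/

section Mahler

open Polynomial

theorem intMinpoly_ne_zero (α : AlgNum) : intMinpoly α ≠ 0 :=
  (intMinpoly_isPrimitive α).ne_zero

theorem aeval_intMinpoly (α : AlgNum) : aeval α (intMinpoly α) = 0 := by
  obtain ⟨q, -, h⟩ := intMinpoly_map α
  have : aeval α ((intMinpoly α).map (algebraMap ℤ ℚ)) = 0 := by
    rw [algebraMap_int_eq, h, map_mul, minpoly.aeval, mul_zero]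
  rwa [aeval_map_algebraMap] at this

theorem exp_mahlerMeas (α : AlgNumˣ) : Real.exp (mahlerMeas α) =
    ((intMinpoly (α : AlgNum)).map (Int.castRingHom ℂ)).mahlerMeasure := by
  rw [mahlerMeas, logMahlerMeasure_eq_log_MahlerMeasure, Real.exp_log]
  exact mahlerMeasure_pos_of_ne_zero
    ((Polynomial.map_ne_zero_iff (RingHom.injective_int _)).mpr (intMinpoly_ne_zero _))

theorem mahlerMeas_nonneg (α : AlgNumˣ) : 0 ≤ mahlerMeas α := by
  rw [← Real.one_le_exp_iff, exp_mahlerMeas]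
  exact one_le_mahlerMeasure_of_ne_zero (intMinpoly_ne_zero _)

theorem abs_leadingCoeff_le_exp_mahlerMeas (α : AlgNumˣ) :
    |((intMinpoly (α : AlgNum)).leadingCoeff : ℝ)| ≤ Real.exp (mahlerMeas α) := by
  rw [exp_mahlerMeas]
  refine le_trans (le_of_eq ?_) (leadingCoeff_le_mahlerMeasure _)
  rw [leadingCoeff_map_of_injective (RingHom.injective_int _)]
  simp

theorem isIntegral_leadingCoeff_mul (α : AlgNum) :
    IsIntegral ℤ (((intMinpoly α).leadingCoeff : AlgNum) * α) := by
  have := isIntegral_leadingCoeff_smul _ _ (aeval_intMinpoly α)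
  rwa [zsmul_eq_mul] at this

/-- An algebraic number that is not an algebraic integer has Mahler measure at least `log 2`. -/
theorem isIntegral_of_mahlerMeas_lt {α : AlgNumˣ} (h : mahlerMeas α < Real.log 2) :
    IsIntegral ℤ (α : AlgNum) := by
  have h1 := (abs_leadingCoeff_le_exp_mahlerMeas α).trans_lt
    ((Real.exp_lt_exp.mpr h).trans_eq (Real.exp_log two_pos))
  have h2 : |(intMinpoly (α : AlgNum)).leadingCoeff| < 2 := by exact_mod_cast h1
  have h0 : (intMinpoly (α : AlgNum)).leadingCoeff ≠ 0 :=
    leadingCoeff_ne_zero.mpr (intMinpoly_ne_zero _)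
  have hi := isIntegral_leadingCoeff_mul (α : AlgNum)
  rw [abs_lt] at h2
  obtain h3 | h3 : (intMinpoly (α : AlgNum)).leadingCoeff = 1 ∨
      (intMinpoly (α : AlgNum)).leadingCoeff = -1 := by omega
  · simpa [h3] using hi
  · simpa [h3] using hi.neg

/-! ### Norms down to a fixed number field. -/

section NumberField

variable {K : Type*} [Field K] [NumberField K] [Algebra K AlgNum]

/-- The monic `minpoly K x` divides `intMinpoly x` over `K`. The cofactor has a nonzero integer as
leading coefficient, hence Mahler measure at least 1, and dropping it does not increase the measure.
-/
theorem norm_coeff_zero_minpoly_le (φ : K →+* ℂ) (x : AlgNumˣ) :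
    ‖φ ((minpoly K (x : AlgNum)).coeff 0)‖ ≤ Real.exp (mahlerMeas x) := by
  have hdvd : minpoly K (x : AlgNum) ∣ (intMinpoly (x : AlgNum)).map (Int.castRingHom K) := by
    refine minpoly.dvd _ _ ?_
    rw [← algebraMap_int_eq, aeval_map_algebraMap, aeval_intMinpoly]
  obtain ⟨h, hh⟩ := hdvd
  have hC : (intMinpoly (x : AlgNum)).map (Int.castRingHom ℂ) =
      (minpoly K (x : AlgNum)).map φ * h.map φ := by
    rw [← Polynomial.map_mul, ← hh, Polynomial.map_map]
    congr 1
    exact Subsingleton.elim _ _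
  have hint : IsIntegral K (x : AlgNum) := by
    have : IsIntegral ℚ (x : AlgNum) :=
      ((AlgebraicClosure.isAlgebraic ℚ).isAlgebraic (x : AlgNum)).isIntegral
    exact this.tower_top
  have hmon : ((minpoly K (x : AlgNum)).map φ).Monic := (minpoly.monic hint).map φ
  have hh1 : 1 ≤ (h.map φ).mahlerMeasure := by
    refine le_trans ?_ (leadingCoeff_le_mahlerMeasure _)
    rw [← one_mul (h.map φ).leadingCoeff, ← hmon.leadingCoeff, ← leadingCoeff_mul, ← hC,
      leadingCoeff_map_of_injective (RingHom.injective_int _)]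
    simp only [eq_intCast, Complex.norm_intCast]
    exact_mod_cast Int.one_le_abs (leadingCoeff_ne_zero.mpr (intMinpoly_ne_zero _))
  -- At index 0 the binomial factor is 1, so no constant depending on the degree appears.
  have := norm_coeff_le_choose_mul_mahlerMeasure_of_one_le_mahlerMeasure 0
    ((minpoly K (x : AlgNum)).map φ) _ hh1
  rw [← hC, ← exp_mahlerMeas] at this
  simpa using this

omit [NumberField K] in
theorem isIntegral_coeff_minpoly {x : AlgNum} (hx : IsIntegral ℤ x) (n : ℕ) :
    IsIntegral ℤ ((minpoly K x).coeff n) := by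
  refine isIntegral_coeff_of_dvd (minpoly ℤ x) _ (minpoly.monic hx) (minpoly.monic hx.tower_top) ?_ n
  refine minpoly.dvd _ _ ?_
  rw [aeval_map_algebraMap, minpoly.aeval]

/-- If the norm of `x` down to a fixed number field is large at one embedding, then the Mahler
measure of `x` is bounded from below. -/
theorem exists_le_mahlerMeas_of_one_lt_norm (φ : K →+* ℂ) : ∃ c : ℝ, 0 < c ∧ ∀ x : AlgNumˣ,
    1 < ‖φ ((minpoly K (x : AlgNum)).coeff 0)‖ → c ≤ mahlerMeas x := by
  -- Only finitely many integers of `K` have all conjugates bounded by 2, so `log ‖φ e‖` has a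
  -- positive minimum over those with `‖φ e‖ > 1`.
  have hfin := (NumberField.Embeddings.finite_of_norm_le K ℂ 2).subset
    (Set.sep_subset _ fun e => 1 < ‖φ e‖)
  set S := {e ∈ {e : K | IsIntegral ℤ e ∧ ∀ ψ : K →+* ℂ, ‖ψ e‖ ≤ 2} | 1 < ‖φ e‖}
  obtain ⟨c, hc, hcS⟩ : ∃ c : ℝ, 0 < c ∧ ∀ e ∈ S, c ≤ Real.log ‖φ e‖ := by
    rcases S.eq_empty_or_nonempty with h | h
    · exact ⟨1, one_pos, by simp [h]⟩
    · obtain ⟨e, he, hmin⟩ := hfin.exists_minimalFor (fun e => Real.log ‖φ e‖) S h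
      refine ⟨Real.log ‖φ e‖, Real.log_pos he.2, fun e' he' => ?_⟩
      rcases le_total (Real.log ‖φ e‖) (Real.log ‖φ e'‖) with h | h
      · exact h
      · exact hmin he' h
  -- Measure below `log 2` both forces integrality and bounds every conjugate of the constant
  -- coefficient by 2.
  refine ⟨min c (Real.log 2), lt_min hc (Real.log_pos one_lt_two), fun x hx => ?_⟩
  by_contra! hlt
  have hint := isIntegral_of_mahlerMeas_lt (hlt.trans_le (min_le_right _ _))
  have hmem : (minpoly K (x : AlgNum)).coeff 0 ∈ S := by
    refine ⟨⟨isIntegral_coeff_minpoly hint 0, fun ψ => ?_⟩, hx⟩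
    refine (norm_coeff_zero_minpoly_le ψ x).trans ?_
    rw [← Real.exp_log two_pos]
    exact Real.exp_le_exp.mpr (hlt.trans_le (min_le_right _ _)).le
  have h1 := hcS _ hmem
  have h2 : Real.log ‖φ ((minpoly K (x : AlgNum)).coeff 0)‖ ≤ mahlerMeas x := by
    rw [Real.log_le_iff_le_exp (one_pos.trans hx)]
    exact norm_coeff_zero_minpoly_le φ x
  exact absurd (h1.trans h2) (not_le.mpr (hlt.trans_le (min_le_left _ _)))

/-- A bound for the absolute value `v` of norms down to `K` in terms of the Mahler measure. -/
def MahlerDominates (v : AbsoluteValue K ℝ) (C c : ℝ) : Prop :=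
  ∀ (E : IntermediateField K AlgNum) [FiniteDimensional K E] (y : E) (x : AlgNumˣ),
    (y : AlgNum) = x →
    Real.log (v (Algebra.norm K y)) ≤ Module.finrank K E * (C * mahlerMeas x) ∧
    (1 < v (Algebra.norm K y) → c ≤ mahlerMeas x)

theorem exists_mahlerDominates_place (φ : K →+* ℂ) :
    ∃ C c : ℝ, 0 < C ∧ 0 < c ∧ MahlerDominates (NumberField.place φ) C c := by
  obtain ⟨c, hc, hcx⟩ := exists_le_mahlerMeas_of_one_lt_norm φ
  refine ⟨1, c, one_pos, hc, fun E _ y x hyx => ?_⟩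
  have hy : IsIntegral K y := Algebra.IsIntegral.isIntegral y
  have hmin : minpoly K y = minpoly K (x : AlgNum) := by
    rw [← hyx]; exact (minpoly.algebraMap_eq (algebraMap E AlgNum).injective y).symm
  -- Up to sign, the norm is the constant coefficient of the minimal polynomial to the power `[E :
  -- K(y)]`.
  have hnorm : NumberField.place φ (Algebra.norm K y) =
      ‖φ ((minpoly K (x : AlgNum)).coeff 0)‖ ^ Module.finrank (IntermediateField.adjoin K {y}) E := by
    rw [NumberField.place_apply, Algebra.norm_eq_norm_adjoin K y,
      ← IntermediateField.adjoin.powerBasis_gen hy,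
      Algebra.PowerBasis.norm_gen_eq_coeff_zero_minpoly,
      IntermediateField.adjoin.powerBasis_gen hy, IntermediateField.minpoly_gen, hmin]
    simp
  set m := Module.finrank (IntermediateField.adjoin K {y}) E
  have hm : m ≤ Module.finrank K E :=
    Nat.le_of_dvd Module.finrank_pos ⟨_, (mul_comm _ _).trans
      (Module.finrank_mul_finrank K (IntermediateField.adjoin K {y}) E) |>.symm⟩
  rw [hnorm, one_mul]
  constructor
  · rw [Real.log_pow]
    have h0 : (minpoly K (x : AlgNum)).coeff 0 ≠ 0 := by
      rw [← hmin]
      refine minpoly.coeff_zero_ne_zero hy ?_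
      rintro rfl
      exact x.ne_zero (by simpa using hyx.symm)
    have h1 : Real.log ‖φ ((minpoly K (x : AlgNum)).coeff 0)‖ ≤ mahlerMeas x := by
      rw [Real.log_le_iff_le_exp (by simpa using h0)]
      exact norm_coeff_zero_minpoly_le φ x
    exact (mul_le_mul_of_nonneg_left h1 m.cast_nonneg).trans
      (mul_le_mul_of_nonneg_right (mod_cast hm) (mahlerMeas_nonneg x))
  · intro h
    refine hcx x ?_
    by_contra! hle
    exact absurd h (not_lt.mpr (pow_le_one₀ (norm_nonneg _) hle))

/-- The leading coefficient `a` of `intMinpoly x` clears the denominators of `x`, and `log |a| ≤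
M(x)`. The factor `[K : ℚ]` comes from comparing `v(a)` with the ordinary absolute value of `a`. -/
theorem exists_mahlerDominates_finitePlace (v : NumberField.FinitePlace K) :
    ∃ C c : ℝ, 0 < C ∧ 0 < c ∧ MahlerDominates v.val C c := by
  refine ⟨Module.finrank ℚ K, Real.log 2, mod_cast Module.finrank_pos, Real.log_pos one_lt_two,
    fun E _ y x hyx => ?_⟩
  have hle : ∀ z : K, IsIntegral ℤ z → v.val z ≤ 1 := by
    intro z hz
    have := NumberField.FinitePlace.norm_le_one (K := K) v.maximalIdeal
      (⟨z, hz⟩ : NumberField.RingOfIntegers K)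
    rwa [NumberField.FinitePlace.norm_embedding_eq] at this
  have hnorm : ∀ z : E, IsIntegral ℤ (z : AlgNum) → IsIntegral ℤ (Algebra.norm K z) := by
    intro z hz
    have : IsIntegral ℤ z := (isIntegral_algHom_iff (E.val.restrictScalars ℤ)
      E.val.injective).mp hz
    exact Algebra.isIntegral_norm K this
  set a := (intMinpoly (x : AlgNum)).leadingCoeff
  have ha0 : a ≠ 0 := leadingCoeff_ne_zero.mpr (intMinpoly_ne_zero _)
  have hexp := abs_leadingCoeff_le_exp_mahlerMeas x
  constructor
  · set D := Module.finrank K E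
    have h1 : v.val (a : K) ^ D * v.val (Algebra.norm K y) ≤ 1 := by
      rw [← map_pow, ← map_mul]
      refine hle _ ?_
      have : Algebra.norm K ((a : E) * y) = (a : K) ^ D * Algebra.norm K y := by
        rw [map_mul, ← map_intCast (algebraMap K E), Algebra.norm_algebraMap]
      rw [← this]
      refine hnorm _ ?_
      push_cast
      rw [hyx]
      exact isIntegral_leadingCoeff_mul _
    -- The power of the prime of `v` dividing `(a)` has norm at most that of `(a)`, which is `|a| ^
    -- [K : ℚ]`.
    have h2 : 1 ≤ v.val (a : K) * |(a : ℝ)| ^ Module.finrank ℚ K := by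
      have h := NumberField.FinitePlace.apply_mul_absNorm_pow_eq_one v
        (x := (a : NumberField.RingOfIntegers K)) (mod_cast ha0)
      have hdvd := map_dvd Ideal.absNorm (pow_multiplicity_dvd v.maximalIdeal.asIdeal
        (Ideal.span {(a : NumberField.RingOfIntegers K)}))
      have habs : Ideal.absNorm (Ideal.span {(a : NumberField.RingOfIntegers K)}) =
          a.natAbs ^ Module.finrank ℚ K := by
        rw [Ideal.absNorm_span_singleton, ← eq_intCast (algebraMap ℤ (NumberField.RingOfIntegers K)),
          Algebra.norm_algebraMap, NumberField.RingOfIntegers.rank, Int.natAbs_pow]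
      rw [habs, map_pow] at hdvd
      have hle := Nat.le_of_dvd (pow_pos (Int.natAbs_pos.mpr ha0) _) hdvd
      have hle' : (Ideal.absNorm v.maximalIdeal.asIdeal : ℝ) ^ multiplicity v.maximalIdeal.asIdeal
          (Ideal.span {(a : NumberField.RingOfIntegers K)}) ≤ |(a : ℝ)| ^ Module.finrank ℚ K := by
        rw [← Int.cast_abs, ← Nat.cast_natAbs]
        exact_mod_cast hle
      rw [← h]
      exact mul_le_mul_of_nonneg_left hle' (v.val.nonneg _)
    have hy0 : y ≠ 0 := by
      rintro rfl
      exact x.ne_zero (by simpa using hyx.symm)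
    have hva : 0 < v.val (a : K) := v.val.pos (mod_cast ha0)
    have hvN : 0 < v.val (Algebra.norm K y) := v.val.pos (Algebra.norm_ne_zero_iff.mpr hy0)
    have haR : 0 < |(a : ℝ)| := abs_pos.mpr (mod_cast ha0)
    have h3 := Real.log_nonpos (by positivity) h1
    have h4 := Real.log_nonneg h2
    rw [Real.log_mul (by positivity) (by positivity), Real.log_pow] at h3 h4
    rw [← Real.log_le_iff_le_exp haR] at hexp
    have h5 : -Real.log (v.val (a : K)) ≤ Module.finrank ℚ K * mahlerMeas x := by
      have := mul_le_mul_of_nonneg_left hexp (Nat.cast_nonneg (α := ℝ) (Module.finrank ℚ K))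
      linarith
    have := mul_le_mul_of_nonneg_left h5 (Nat.cast_nonneg (α := ℝ) D)
    linarith
  · intro h
    by_contra! hlt
    refine absurd h (not_lt.mpr (hle _ (hnorm _ ?_)))
    rw [hyx]
    exact isIntegral_of_mahlerMeas_lt hlt

/-- Kronecker's theorem: a nonzero element of a number field that is not a root of unity is
larger than `1` at some place. -/
theorem exists_mahlerDominates {α : K} (h0 : α ≠ 0) (hα : ∀ n, 0 < n → α ^ n ≠ 1) :
    ∃ (v : AbsoluteValue K ℝ) (C c : ℝ), 0 < C ∧ 0 < c ∧ MahlerDominates v C c ∧ 1 < v α := by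
  by_cases hint : IsIntegral ℤ α
  · obtain ⟨φ, hφ⟩ : ∃ φ : K →+* ℂ, 1 < ‖φ α‖ := by
      by_contra! h
      obtain ⟨n, hn, h⟩ := NumberField.Embeddings.pow_eq_one_of_norm_le_one K ℂ h0 hint h
      exact hα n hn h
    obtain ⟨C, c, hC, hc, h⟩ := exists_mahlerDominates_place φ
    exact ⟨_, C, c, hC, hc, h, hφ⟩
  · obtain ⟨w, hw⟩ : ∃ w : IsDedekindDomain.HeightOneSpectrum (NumberField.RingOfIntegers K),
        1 < w.valuation K α := by
      by_contra! h
      obtain ⟨z, rfl⟩ :=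
        IsDedekindDomain.HeightOneSpectrum.mem_integers_of_valuation_le_one K α h
      exact hint z.2
    obtain ⟨C, c, hC, hc, h⟩ := exists_mahlerDominates_finitePlace (NumberField.FinitePlace.mk w)
    refine ⟨_, C, c, hC, hc, h, ?_⟩
    change 1 < NumberField.FinitePlace.mk w α
    rw [NumberField.FinitePlace.mk_apply, NumberField.FinitePlace.norm_embedding']
    have := WithZeroMulInt.toNNReal_strictMono
      (NumberField.HeightOneSpectrum.one_lt_absNorm_nnreal w) hw
    rw [map_one] at this
    exact_mod_cast this

end NumberField

end Mahler

/-! ### Growth of `M_t` along powers. -/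

theorem mahlerMeas_one : mahlerMeas 1 = 0 := mahlerMeas_eq_zero_of_isOfFinOrder IsOfFinOrder.one

/-- The `t`-norms of the Mahler measures in a factorization of `α ^ s` grow with `s`. -/
theorem MahlerDominates.mul_le_finsum_mahlerMeas_rpow {K : Type*} [Field K] [NumberField K]
    [Algebra K AlgNum] {v : AbsoluteValue K ℝ} {C c : ℝ} (hC : 0 < C) (hc : 0 < c)
    (hdom : MahlerDominates v C c) {p : ℝ} (hp : 1 ≤ p) {α' : K} {α : AlgNumˣ}
    (hα' : algebraMap K AlgNum α' = α) {s : ℕ} {a : ℕ → AlgNumˣ} (ha : a ∈ factorizations (α ^ s)) :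
    s * (c ^ (p - 1) * Real.log (v α') / C) ≤ ∑ᶠ n, |mahlerMeas (a n)| ^ p := by
  set T := ha.1.toFinset with hT
  set S : Set AlgNum := (fun n => (a n : AlgNum)) '' T
  have hSfin : Finite S := (T.finite_toSet.image _).to_subtype
  set E := IntermediateField.adjoin K S
  have : FiniteDimensional K E :=
    IntermediateField.finiteDimensional_adjoin fun x _ =>
      ((AlgebraicClosure.isAlgebraic ℚ).isAlgebraic x).isIntegral.tower_top
  have hmem : ∀ n, (a n : AlgNum) ∈ E := by
    intro n
    by_cases hn : n ∈ T
    · exact IntermediateField.subset_adjoin K S ⟨n, hn, rfl⟩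
    · have : a n = 1 := by simpa [hT] using hn
      rw [this]
      exact one_mem E
  set y : ℕ → E := fun n => ⟨a n, hmem n⟩
  have hy0 : ∀ n, y n ≠ 0 := fun n h => (a n).ne_zero (congrArg Subtype.val h)
  have hprod : ∏ n ∈ T, y n = algebraMap K E (α' ^ s) := by
    apply Subtype.ext
    have h1 : ∏ n ∈ T, a n = α ^ s := by rw [← ha.2, finprod_eq_prod _ ha.1]
    have h2 := congrArg (Units.val) h1
    rw [Units.coe_prod, Units.val_pow_eq_pow_val] at h2
    have h3 : ((algebraMap K E (α' ^ s) : E) : AlgNum) = (α : AlgNum) ^ s := by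
      rw [← hα']; exact map_pow (algebraMap K AlgNum) α' s
    rw [h3, ← h2]
    exact map_prod E.val y T
  set D := Module.finrank K E
  have hD : (0 : ℝ) < D := mod_cast Module.finrank_pos
  have hlog : D * (s * Real.log (v α')) = ∑ n ∈ T, Real.log (v (Algebra.norm K (y n))) := by
    rw [← Real.log_prod fun n _ => (v.pos (Algebra.norm_ne_zero_iff.mpr (hy0 n))).ne', ← map_prod,
      ← map_prod, hprod, Algebra.norm_algebraMap, map_pow, map_pow, Real.log_pow, Real.log_pow]
  -- Factors with `v(N) ≤ 1` have a nonpositive left side. For the others `c ≤ M`, so `p - 1` of the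
  -- `p` powers of `M` absorb `c ^ (p - 1)`.
  have hterm : ∀ n, c ^ (p - 1) * Real.log (v (Algebra.norm K (y n))) ≤
      D * (C * |mahlerMeas (a n)| ^ p) := by
    intro n
    obtain ⟨h1, h2⟩ := hdom E (y n) (a n) rfl
    have hM := mahlerMeas_nonneg (a n)
    rw [abs_of_nonneg hM]
    rcases le_or_gt (v (Algebra.norm K (y n))) 1 with h | h
    · exact (mul_nonpos_of_nonneg_of_nonpos (by positivity)
        (Real.log_nonpos (v.nonneg _) h)).trans (by positivity)
    · have hcM := h2 h
      have h3 : mahlerMeas (a n) ^ p = mahlerMeas (a n) ^ (p - 1) * mahlerMeas (a n) := by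
        rw [← Real.rpow_add_one (hc.trans_le hcM).ne', sub_add_cancel]
      have h4 : c ^ (p - 1) ≤ mahlerMeas (a n) ^ (p - 1) :=
        Real.rpow_le_rpow hc.le hcM (by linarith)
      calc _ ≤ mahlerMeas (a n) ^ (p - 1) * (D * (C * mahlerMeas (a n))) :=
            mul_le_mul h4 h1 (Real.log_nonneg h.le) (by positivity)
        _ = _ := by rw [h3]; ring
  have hsum : ∑ᶠ n, |mahlerMeas (a n)| ^ p = ∑ n ∈ T, |mahlerMeas (a n)| ^ p := by
    refine finsum_eq_sum_of_support_subset _ fun n hn => ?_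
    by_contra h
    have : a n = 1 := by simpa [hT] using h
    exact hn (by simp [this, mahlerMeas_one, Real.zero_rpow (by linarith : p ≠ 0)])
  have key : c ^ (p - 1) * (D * (s * Real.log (v α'))) ≤
      D * (C * ∑ n ∈ T, |mahlerMeas (a n)| ^ p) := by
    rw [hlog, Finset.mul_sum, Finset.mul_sum, Finset.mul_sum]
    exact Finset.sum_le_sum fun n _ => hterm n
  rw [hsum, ← mul_div_assoc, div_le_iff₀ hC]
  -- The degree `D` depends on the factorization, but it occurs on both sides and cancels.
  refine le_of_mul_le_mul_left ?_ hD
  linarith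

theorem exists_mul_le_finsum_mahlerMeas_rpow {p : ℝ} (hp : 1 ≤ p) {α : AlgNumˣ}
    (hα : ¬ IsOfFinOrder α) : ∃ A : ℝ, 0 < A ∧ ∀ (s : ℕ), ∀ a ∈ factorizations (α ^ s),
      s * A ≤ ∑ᶠ n, |mahlerMeas (a n)| ^ p := by
  have hint : ∀ x : AlgNum, IsIntegral ℚ x := fun x =>
    ((AlgebraicClosure.isAlgebraic ℚ).isAlgebraic x).isIntegral
  set K := IntermediateField.adjoin ℚ {(α : AlgNum)}
  have : FiniteDimensional ℚ K := IntermediateField.adjoin.finiteDimensional (hint _)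
  have : NumberField K := { to_charZero := inferInstance, to_finiteDimensional := this }
  set α' : K := IntermediateField.AdjoinSimple.gen ℚ (α : AlgNum)
  have hα' : algebraMap K AlgNum α' = α := rfl
  have hα0 : α' ≠ 0 := fun h => α.ne_zero (by rw [← hα', h, map_zero])
  obtain ⟨v, C, c, hC, hc, hdom, hv⟩ := exists_mahlerDominates hα0 (by
    intro n hn h
    refine hα (isOfFinOrder_iff_pow_eq_one.mpr ⟨n, hn, Units.ext ?_⟩)
    rw [Units.val_pow_eq_pow_val, ← hα', ← map_pow, h, map_one, Units.val_one])
  refine ⟨c ^ (p - 1) * Real.log (v α') / C,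
    div_pos (mul_pos (Real.rpow_pos_of_pos hc _) (Real.log_pos hv)) hC, fun s a ha =>
      hdom.mul_le_finsum_mahlerMeas_rpow hC hc hp hα' ha⟩

theorem tendsto_metricMahler_pow {t : ℝ≥0∞} (ht : 1 ≤ t) (ht' : t < ∞) {α : AlgNumˣ}
    (hα : ¬ IsOfFinOrder α) :
    Filter.Tendsto (fun s : ℕ => metricMahler t (α ^ s)) Filter.atTop Filter.atTop := by
  have hp : 1 ≤ t.toReal := by
    simpa using (ENNReal.toReal_le_toReal ENNReal.one_ne_top ht'.ne).mpr ht
  obtain ⟨A, hA, h⟩ := exists_mul_le_finsum_mahlerMeas_rpow hp hα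
  have hlim : Filter.Tendsto (fun s : ℕ => ((s : ℝ) * A) ^ (1 / t.toReal)) Filter.atTop
      Filter.atTop :=
    (tendsto_rpow_atTop (by positivity)).comp
      (tendsto_natCast_atTop_atTop.atTop_mul_const hA)
  refine Filter.tendsto_atTop_mono (fun s => ?_) hlim
  refine le_metricVersion fun a ha => ?_
  rw [tNorm, if_neg ht'.ne]
  exact Real.rpow_le_rpow (by positivity) (h s a ha) (by positivity)

/-! ### Comparison of the topologies. -/

theorem metricMahlerQuot_mk (t : ℝ≥0∞) (α : AlgNumˣ) :
    metricMahlerQuot t (α : AlgModTors) = metricMahler t α := rfl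

/-- Under Lehmer's conjecture, the topologies of the metric Mahler measures are discrete. -/
theorem mahlerTopology_eq_bot (h : LehmerConjecture) {t : ℝ≥0∞} (ht : t ≠ 0) :
    mahlerTopology t = ⊥ := by
  obtain ⟨c, hc, h⟩ := h
  rw [eq_bot_iff]
  intro U _ v hv
  refine ⟨c, hc, fun w hw => ?_⟩
  obtain ⟨x, hx⟩ := QuotientGroup.mk_surjective (v * w⁻¹)
  rw [Set.mem_ofPred_eq, ← hx, metricMahlerQuot_mk] at hw
  have hfin : IsOfFinOrder x := by
    by_contra hx
    refine absurd hw (not_lt.mpr (le_metricVersion fun a ha => ?_))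
    -- Torsion is a subgroup, so some factor is non-torsion; that entry alone makes the `t`-norm at
    -- least `c`.
    obtain ⟨n, hn⟩ : ∃ n, ¬ IsOfFinOrder (a n) := by
      by_contra! hall
      refine hx (show x ∈ CommGroup.torsion AlgNumˣ from ?_)
      rw [← show ∏ᶠ n, a n = x from ha.2, finprod_eq_prod _ ha.1]
      exact Subgroup.prod_mem _ fun n _ => hall n
    exact ((h _ hn).trans (le_abs_self _)).trans
      (abs_le_tNorm ht (support_comp_finite mahlerMeas_one ha) n)
  have h1 : v * w⁻¹ = 1 := by
    rw [← hx]
    exact (QuotientGroup.eq_one_iff x).mpr hfin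
  rwa [← mul_inv_eq_one.mp h1]

theorem metricMahlerQuot_mul_le {t : ℝ≥0∞} (ht : 1 ≤ t) (ht' : t < ∞) (v w : AlgModTors) :
    metricMahlerQuot t (v * w) ≤ metricMahlerQuot t v + metricMahlerQuot t w := by
  obtain ⟨x, rfl⟩ := QuotientGroup.mk_surjective v
  obtain ⟨y, rfl⟩ := QuotientGroup.mk_surjective w
  exact metricVersion_mul_le mahlerMeas_one ht ht'.ne x y

theorem lehmerConjecture_of_mahlerTopology_eq {t : ℝ≥0∞} (ht : 1 ≤ t) (ht' : t < ∞)
    (h : mahlerTopology t = mahlerTopology ∞) : LehmerConjecture := by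
  -- This is the unit `M_t`-ball about 1; the inverse matches the `v * w⁻¹` convention at `v = 1`.
  -- It is open by the triangle inequality.
  set U : Set AlgModTors := {w | metricMahlerQuot t w⁻¹ < 1} with hU
  have hopen : @IsOpen _ (mahlerTopology t) U := by
    intro v (hv : metricMahlerQuot t v⁻¹ < 1)
    refine ⟨1 - metricMahlerQuot t v⁻¹, by linarith, fun w hw => ?_⟩
    rw [Set.mem_ofPred_eq] at hw
    have := metricMahlerQuot_mul_le ht ht' v⁻¹ (v * w⁻¹)
    rw [inv_mul_cancel_left] at this
    change metricMahlerQuot t w⁻¹ < 1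
    linarith
  rw [h] at hopen
  have h1 : (1 : AlgModTors) ∈ U := by
    have : metricMahlerQuot t 1 = 0 :=
      metricVersion_one mahlerMeas_one (one_pos.trans_le ht).ne'
    rw [hU, Set.mem_ofPred_eq, inv_one, this]
    exact one_pos
  obtain ⟨r, hr, hrU⟩ := hopen 1 h1
  refine ⟨r, hr, fun α hα => ?_⟩
  by_contra! hlt
  obtain ⟨s, hs⟩ := ((tendsto_metricMahler_pow ht ht' hα).eventually_ge_atTop 1).exists
  -- `M_∞(α ^ s) ≤ M(α) < r` puts the inverse power in the `M_∞`-ball, hence in `U`, against the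
  -- choice of `s` with `M_t(α ^ s) ≥ 1`.
  have hmem : ((α ^ s)⁻¹ : AlgNumˣ) ∈ (fun x : AlgNumˣ => (x : AlgModTors)) ⁻¹' U := by
    refine hrU ?_
    change metricMahler ∞ (1 * (α ^ s)⁻¹⁻¹) < r
    rw [one_mul, inv_inv]
    exact (metricVersion_top_pow_le mahlerMeas_nonneg mahlerMeas_one α s).trans_lt hlt
  have : metricMahler t ((α ^ s)⁻¹⁻¹) < 1 := hmem
  rw [inv_inv] at this
  linarith

/-- Lehmer's conjecture holds if and only if, for some `t ∈ [1, ∞)`, the `t`-metric Mahler measure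
and the ultrametric Mahler measure induce the same topology on the nonzero algebraic numbers modulo
roots of unity. Moreover, for every `t ∈ [1, ∞)` and every `α` that is not a root of unity,
`M_t(α ^ s)` tends to infinity with `s`. -/
theorem mainTheorem1 :
    (LehmerConjecture ↔
      ∃ t : ℝ≥0∞, 1 ≤ t ∧ t < ∞ ∧ mahlerTopology t = mahlerTopology ∞) ∧
    (∀ t : ℝ≥0∞, 1 ≤ t → t < ∞ → ∀ α : AlgNumˣ, ¬ IsOfFinOrder α →
      Filter.Tendsto (fun s : ℕ => metricMahler t (α ^ s)) Filter.atTop Filter.atTop) := by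
  refine ⟨⟨fun h => ⟨1, le_rfl, ENNReal.one_lt_top, ?_⟩, ?_⟩, ?_⟩
  · rw [mahlerTopology_eq_bot h one_ne_zero, mahlerTopology_eq_bot h ENNReal.top_ne_zero]
  · rintro ⟨t, ht, ht', h⟩
    exact lehmerConjecture_of_mahlerTopology_eq ht ht' h
  · exact fun t ht ht' α hα => tendsto_metricMahler_pow ht ht' hα
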